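/- **Conventions.** Let $\mathbb N=\{1,2,\dots\}$ and let $[\mathbb N]^{<\omega}$ be the set of finite subsets of $\mathbb N$. For $a,b\in[\mathbb N]^{<\omega}$ write $a<b$ if every element of $a$ is smaller than every element of $b$. A *finite disjoint collection* is a finite (possibly empty) set $\mathbf s=\{s_1<\dots<s_k\}$ of non-empty finite subsets of $\mathbb N$; an *infinite disjoint collection* is an infinite set $\mathcal D=\{s_1<s_2<\cdots\}$ of non-empty finite subsets of $\mathbb N$. The sets of these are $\mathcal B^{<\omega}(\mathbb N)$ and $\mathcal B^{\omega}(\mathbb N)$. $FU(\mathcal D)$ is the set of unions of finitely many (at least one) members of $\mathcal D$. Write $\mathcal D_1<\mathcal D_2$ if $\mathcal D_1\subseteq FU(\mathcal D_2)$, let $\mathcal B^{<\omega}(\mathcal D)$ be the set of finite disjoint collections with all members in $FU(\mathcal D)$, and write $\mathbf s\propto\mathcal D$ if $\mathbf s$ is an initial segment of $\mathcal D$. For a finite set $\mathbf s$ of finite subsets of $\mathbb N$ and $\mathcal D\in\mathcal B^\omega(\mathbb N)$ put $$[\mathbf s,\mathcal D]=\{\mathcal D_1\in\mathcal B^\omega(\mathbb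 N):\ \mathbf s\propto\mathcal D_1\ \text{and}\ \{d\in\mathcal D_1: \textstyle\bigcup\mathbf s<d\}\subseteq FU(\mathcal D)\}$$ (empty if $\mathbf s$ is not a finite disjoint collection). $\mathfrak T_E$ is the topology on $\mathcal B^\omega(\mathbb N)$ generated by the sets $[\mathbf s,\mathcal D]$ with $\mathbf s\in\mathcal B^{<\omega}(\mathbb N)$, $\mathcal D\in\mathcal B^\omega(\mathbb N)$, and $\hat{\mathcal U}$ is the $\mathfrak T_E$-closure of $\mathcal U\subseteq\mathcal B^\omega(\mathbb N)$. **Schreier families.** For every non-zero countable limit ordinal $\lambda$ fix a strictly increasing sequence $(\lambda_n)_{n\ge1}$ of successor ordinals smaller than $\lambda$ with $\sup_n\lambda_n=\lambda$. Define families $\mathcal A_\xi\subseteq[\mathbb N]^{<\omega}$, $\xi<\omega_1$, recursively: 1. $\mathcal A_0=\{\emptyset\}$; 2. $\mathcal A_{\zeta+1}=\{\{n\}\cup s: n\in\mathbb N,\ \{n\}<s,\ s\in\mathcal A_\zeta\}$; 3. $\mathcal A_{\omega^{\beta+1}}=\{s_1\cup\dots\cup s_n: s_1<\dots<s_n,\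 s_i\in\mathcal A_{\omega^\beta},\ n=\min s_1\}$; 4. $\mathcal A_{\omega^\lambda}=\{s\ne\emptyset: s\in\mathcal A_{\omega^{\lambda_n}}\text{ for } n=\min s\}$ for a non-zero countable limit ordinal $\lambda$; 5. if $\xi=\omega^{a_0}p_0+\dots+\omega^{a_m}p_m$ with $a_0>\dots>a_m>0$, integers $p_i\ge1$, and $p_0>1$ or $m\ge1$, then $\mathcal A_\xi$ consists of the sets $s_0\cup\dots\cup s_m$ with $s_m<\dots<s_0$, where each $s_i=s^i_1\cup\dots\cup s^i_{p_i}$ with $s^i_1<\dots<s^i_{p_i}$ in $\mathcal A_{\omega^{a_i}}$. Let $\mathcal B^0=\{\emptyset\}$ and, for $1\le\xi<\omega_1$, let $\mathcal B^\xi$ be the set of non-empty finite disjoint collections $\{s_1<\dots<s_k\}$ with $\{\min s_1,\dots,\min s_k\}\in\mathcal A_\xi$. **Theorem 4.2.** For every choice of the sequences $(\lambda_n)$ the following holds. Let $\mathcal U\subseteq\mathcal B^\omega(\mathbb N)$, $\mathbf s\in\mathcal B^{<\omega}(\mathbb N)$ and $\mathcal D\in\mathcal B^\omega(\mathbb N)$.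 Then * either there exists $\mathcal D_1<\mathcal D$ in $\mathcal B^\omega(\mathbb N)$ such that $[\mathbf s,\mathcal D_1]\subseteq\hat{\mathcal U}$; * or there exists a countable ordinal $\xi_0$ such that for every countable ordinal $\xi>\xi_0$ there exists $\mathcal D_1<\mathcal D$ in $\mathcal B^\omega(\mathbb N)$ with $[\mathbf s\cup\mathbf t,\mathcal D_1]\subseteq\mathcal B^\omega(\mathbb N)\setminus\mathcal U$ for every $\mathbf t\in\mathcal B^\xi\cap\mathcal B^{<\omega}(\mathcal D_1)$. -/

import Mathlib

open scoped Ordinal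

namespace BlockSchreier

/-! Throughout, the natural numbers are `{1, 2, …}`, that is, `ℕ+`. -/

/-- `s < t` for finite sets of natural numbers: every element of `s` lies below every element of
`t` (for non-empty `s`, `t` this is `max s < min t`; it holds when one of them is empty). -/
def BlockLT (s t : Finset ℕ+) : Prop := ∀ x ∈ s, ∀ y ∈ t, x < y

/-- A choice, for every non-zero countable limit ordinal `l`, of a strictly increasing sequence
`(l_n)`, `n = 1, 2, …`, of successor ordinals smaller than `l` with supremum `l`. -/
def IsFundamentalChoice (lam : Ordinal.{0} → ℕ+ → Ordinal.{0}) : Prop :=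
  ∀ l : Ordinal.{0}, l < ω₁ → Order.IsSuccLimit l →
    StrictMono (lam l) ∧ (∀ n, ∃ β, lam l n = β + 1) ∧ (∀ n, lam l n < l) ∧
      IsLUB (Set.range (lam l)) l

/-- The recursive thin Schreier system: `Schreier lam ξ s` says that `s` belongs to the family
`𝒜_ξ` built from the sequences `lam`. The five clauses concern disjoint classes of ordinals
(zero; successors; `ω ^ (β + 1)`; `ω ^ l` with `l` a limit; the other limits, in Cantor normal
form), and each of them refers to smaller ordinals only. -/
inductive Schreier (lam : Ordinal.{0} → ℕ+ → Ordinal.{0}) : Ordinal.{0} → Finset ℕ+ → Prop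
  /-- `𝒜_0 = {∅}`. -/
  | zero : Schreier lam 0 ∅
  /-- `𝒜_{ζ+1}`: the sets `{n} ∪ s` with `{n} < s` and `s ∈ 𝒜_ζ`. -/
  | succ (ζ : Ordinal.{0}) (n : ℕ+) (s : Finset ℕ+) (hlt : BlockLT {n} s)
      (hs : Schreier lam ζ s) : Schreier lam (ζ + 1) (insert n s)
  /-- `𝒜_{ω^(β+1)}`: the unions of `s_1 < ⋯ < s_n` in `𝒜_{ω^β}` with `n = min s_1`. -/
  | opow_succ (β : Ordinal.{0}) (n : ℕ+) (s : Fin (n : ℕ) → Finset ℕ+)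
      (hmin : IsLeast (s ⟨0, n.pos⟩ : Set ℕ+) n)
      (hlt : ∀ i j, i < j → BlockLT (s i) (s j))
      (hs : ∀ i, Schreier lam (ω ^ β) (s i)) :
      Schreier lam (ω ^ (β + 1)) (Finset.univ.biUnion s)
  /-- `𝒜_{ω^l}`, `l` a limit: the sets `s` with `s ∈ 𝒜_{ω^(l_n)}` for `n = min s`. -/
  | opow_limit (l : Ordinal.{0}) (hl : Order.IsSuccLimit l) (n : ℕ+) (s : Finset ℕ+)
      (hmin : IsLeast (s : Set ℕ+) n) (hs : Schreier lam (ω ^ lam l n) s) :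
      Schreier lam (ω ^ l) s
  /-- `𝒜_ξ` for `ξ = ω^(a_0) p_0 + ⋯ + ω^(a_m) p_m`, with `a_0 > ⋯ > a_m > 0`, all `p_i ≥ 1`,
  and either `p_0 > 1` or `m ≥ 1`: the unions `s_0 ∪ ⋯ ∪ s_m` with `s_m < ⋯ < s_0`, where each
  `s_i` is the union of `p_i` successive members of `𝒜_{ω^(a_i)}`. -/
  | sum (m : ℕ) (a : Fin (m + 1) → Ordinal.{0}) (p : Fin (m + 1) → ℕ)
      (ha : StrictAnti a) (ha0 : ∀ i, 0 < a i) (hp : ∀ i, 1 ≤ p i) (hne : 1 < p 0 ∨ 1 ≤ m)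
      (s : (i : Fin (m + 1)) → Fin (p i) → Finset ℕ+)
      (hlt : ∀ i, ∀ k k', k < k' → BlockLT (s i k) (s i k'))
      (hlt' : ∀ i j, i < j → ∀ k k', BlockLT (s j k) (s i k'))
      (hs : ∀ i k, Schreier lam (ω ^ a i) (s i k)) :
      Schreier lam (List.ofFn fun i => ω ^ a i * (p i : Ordinal.{0})).sum
        (Finset.univ.biUnion fun i => Finset.univ.biUnion fun k => s i k)

/-- A (block) disjoint collection: its members are non-empty, and any two distinct members are
successive. A finite or infinite such collection is the same thing as an increasing sequence
`s_1 < s_2 < ⋯` of non-empty finite sets. -/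
def IsDisjointCollection (C : Set (Finset ℕ+)) : Prop :=
  (∀ s ∈ C, s.Nonempty) ∧ C.Pairwise fun s t => BlockLT s t ∨ BlockLT t s

/-- The set of all finite disjoint collections (including the empty one). -/
def FinColl : Set (Finset (Finset ℕ+)) := {s | IsDisjointCollection (s : Set (Finset ℕ+))}

/-- The space of all infinite disjoint collections. -/
structure InfColl where
  /-- the members of the collection -/
  carrier : Set (Finset ℕ+)
  infinite : carrier.Infinite
  isDisjointCollection : IsDisjointCollection carrier

/-- `FU(C)`: the finite unions of (one or more) members of `C`. -/
def FU (C : Set (Finset ℕ+)) : Set (Finset ℕ+) :=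
  {u | ∃ f : Finset (Finset ℕ+), f.Nonempty ∧ (f : Set (Finset ℕ+)) ⊆ C ∧ u = f.biUnion id}

/-- `D₁ < D₂` for infinite disjoint collections: `D₁ ⊆ FU(D₂)`. -/
def Refines (D₁ D₂ : InfColl) : Prop := D₁.carrier ⊆ FU D₂.carrier

/-- The finite disjoint collections with members in `FU(D)`. -/
def finCollIn (D : InfColl) : Set (Finset (Finset ℕ+)) :=
  {t | t ∈ FinColl ∧ (t : Set (Finset ℕ+)) ⊆ FU D.carrier}

/-- `s` is an initial segment of the infinite disjoint collection `D`. -/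
def IsInitialSegment (s : Finset (Finset ℕ+)) (D : InfColl) : Prop :=
  (s : Set (Finset ℕ+)) ⊆ D.carrier ∧ ∀ a ∈ s, ∀ b ∈ D.carrier, b ∉ s → BlockLT a b

/-- The basic set `[s, D]`: all `D₁` having `s` as an initial segment and such that the members
of `D₁` that lie after `⋃ s` belong to `FU(D)`. -/
def basicSet (s : Finset (Finset ℕ+)) (D : InfColl) : Set InfColl :=
  {D₁ | IsInitialSegment s D₁ ∧ {d ∈ D₁.carrier | BlockLT (s.biUnion id) d} ⊆ FU D.carrier}

/-- The Ellentuck-type topology on the infinite disjoint collections, generated by the sets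
`[s, D]` with `s` a finite and `D` an infinite disjoint collection. -/
abbrev ellentuckTopology : TopologicalSpace InfColl :=
  TopologicalSpace.generateFrom {V | ∃ s ∈ FinColl, ∃ D : InfColl, V = basicSet s D}

/-- The closure of a family in the Ellentuck-type topology. -/
def ellentuckClosure (U : Set InfColl) : Set InfColl := @closure InfColl ellentuckTopology U

/-- The minimum of a non-empty finite set (the value at `∅` plays no role). -/
def blockMin (a : Finset ℕ+) : ℕ+ := if h : a.Nonempty then a.min' h else 1

/-- The block Schreier family: `ℬ^0 = {∅}`, and for `ξ ≥ 1` the family `ℬ^ξ` consists of the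
non-empty finite disjoint collections `(s_1, …, s_k)` with `{min s_1, …, min s_k} ∈ 𝒜_ξ`. -/
def blockFamily (lam : Ordinal.{0} → ℕ+ → Ordinal.{0}) (ξ : Ordinal.{0}) :
    Set (Finset (Finset ℕ+)) :=
  {s | (ξ = 0 ∧ s = ∅) ∨
    (1 ≤ ξ ∧ s ∈ FinColl ∧ s.Nonempty ∧ Schreier lam ξ (s.image blockMin))}

end BlockSchreier

namespace BlockSchreier

/-! ### Finite unions and the block order -/

/-! The complement `O` of the closure of `U` is open, and open families are Ramsey
(`exists_refines_basicSet_subset_or`): some refinement `D₁` of `D` has `[s, D₁]` inside `O` or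
inside the closure. The second case is the first alternative. In the first case `[s, D₁]` misses
`U`; if `D` was cut to its tail past `⋃ s`, every `t` from `D₁` lies after `s`, so `[s ∪ t, D₁] ⊆
[s, D₁]` misses `U` too. Hence `ξ₀ = 0` works, with one `D₁` for all `ξ`.

The Ramsey property is the Nash-Williams accept/reject argument. The pigeonhole step is Hindman's
theorem for finite unions (`exists_refines_FU_subset_or`), and `exists_fusion` makes countably many
choices hold on a single refinement. -/

theorem BlockLT.mono {a a' b b' : Finset ℕ+} (h : BlockLT a b) (ha : a' ⊆ a) (hb : b' ⊆ b) :
    BlockLT a' b' := fun x hx y hy => h x (ha hx) y (hb hy)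

theorem BlockLT.trans {a b c : Finset ℕ+} (hab : BlockLT a b) (hb : b.Nonempty)
    (hbc : BlockLT b c) : BlockLT a c := by
  obtain ⟨y, hy⟩ := hb
  exact fun x hx z hz => (hab x hx y hy).trans (hbc y hy z hz)

theorem BlockLT.union_left {a b c : Finset ℕ+} (ha : BlockLT a c) (hb : BlockLT b c) :
    BlockLT (a ∪ b) c := by
  intro x hx y hy
  rcases Finset.mem_union.1 hx with h | h
  · exact ha x h y hy
  · exact hb x h y hy

theorem blockLT_biUnion_left {f : Finset (Finset ℕ+)} {b : Finset ℕ+} :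
    BlockLT (f.biUnion id) b ↔ ∀ a ∈ f, BlockLT a b := by
  constructor
  · exact fun h a ha => h.mono (Finset.subset_biUnion_of_mem id ha) subset_rfl
  · intro h x hx y hy
    obtain ⟨a, ha, hxa⟩ := Finset.mem_biUnion.1 hx
    exact h a ha x hxa y hy

theorem blockLT_biUnion_right {f : Finset (Finset ℕ+)} {a : Finset ℕ+} :
    BlockLT a (f.biUnion id) ↔ ∀ b ∈ f, BlockLT a b := by
  constructor
  · exact fun h b hb => h.mono subset_rfl (Finset.subset_biUnion_of_mem id hb)
  · intro h x hx y hy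
    obtain ⟨b, hb, hyb⟩ := Finset.mem_biUnion.1 hy
    exact h b hb x hx y hyb

theorem subset_FU (C : Set (Finset ℕ+)) : C ⊆ FU C := fun d hd =>
  ⟨{d}, Finset.singleton_nonempty d, by simpa using hd, by simp⟩

theorem union_mem_FU {C : Set (Finset ℕ+)} {u v : Finset ℕ+} (hu : u ∈ FU C) (hv : v ∈ FU C) :
    u ∪ v ∈ FU C := by
  obtain ⟨f, hf, hfC, rfl⟩ := hu
  obtain ⟨g, -, hgC, rfl⟩ := hv
  refine ⟨f ∪ g, hf.mono Finset.subset_union_left, ?_, ?_⟩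
  · rw [Finset.coe_union]; exact Set.union_subset hfC hgC
  · ext x; simp [or_and_right, exists_or]

theorem biUnion_mem_FU {C : Set (Finset ℕ+)} {f : Finset (Finset ℕ+)} (hf : f.Nonempty)
    (h : ∀ a ∈ f, a ∈ FU C) : f.biUnion id ∈ FU C := by
  induction hf using Finset.Nonempty.cons_induction with
  | singleton a => simpa using h a (by simp)
  | cons a s ha hs ih =>
    rw [Finset.cons_eq_insert, Finset.biUnion_insert]
    exact union_mem_FU (h a (by simp)) (ih fun b hb => h b (by simp [hb]))

theorem FU_subset_FU {C C' : Set (Finset ℕ+)} (h : C ⊆ FU C') : FU C ⊆ FU C' := by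
  rintro u ⟨f, hf, hfC, rfl⟩
  exact biUnion_mem_FU hf fun a ha => h (hfC ha)

theorem nonempty_of_mem_FU {C : Set (Finset ℕ+)} (hC : ∀ a ∈ C, a.Nonempty) {u : Finset ℕ+}
    (hu : u ∈ FU C) : u.Nonempty := by
  obtain ⟨f, ⟨a, ha⟩, hfC, rfl⟩ := hu
  exact (hC a (hfC ha)).mono (Finset.subset_biUnion_of_mem id ha)

theorem InfColl.nonempty_of_mem_FU (D : InfColl) {u : Finset ℕ+} (hu : u ∈ FU D.carrier) :
    u.Nonempty :=
  BlockSchreier.nonempty_of_mem_FU D.isDisjointCollection.1 hu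

/-- A finite union lying above `a` is a union of members lying above `a`. -/
theorem mem_FU_of_blockLT {C C' : Set (Finset ℕ+)} {a u : Finset ℕ+}
    (h : {d ∈ C | BlockLT a d} ⊆ FU C') (hu : u ∈ FU C) (hau : BlockLT a u) : u ∈ FU C' := by
  obtain ⟨f, hf, hfC, rfl⟩ := hu
  exact biUnion_mem_FU hf fun b hb => h ⟨hfC hb, blockLT_biUnion_right.1 hau b hb⟩

theorem Refines.refl (D : InfColl) : Refines D D := subset_FU _

theorem Refines.FU_subset {D₁ D₂ : InfColl} (h : Refines D₁ D₂) :
    FU D₁.carrier ⊆ FU D₂.carrier := FU_subset_FU h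

theorem Refines.trans {D₁ D₂ D₃ : InfColl} (h : Refines D₁ D₂) (h' : Refines D₂ D₃) :
    Refines D₁ D₃ := Set.Subset.trans h h'.FU_subset

theorem Refines.blockLT {D₁ D₂ : InfColl} (h : Refines D₁ D₂) {a : Finset ℕ+}
    (ha : ∀ d ∈ D₂.carrier, BlockLT a d) {u : Finset ℕ+} (hu : u ∈ FU D₁.carrier) :
    BlockLT a u := by
  obtain ⟨f, -, hfC, rfl⟩ := h.FU_subset hu
  exact blockLT_biUnion_right.2 fun b hb => ha b (hfC hb)

/-! ### Tails, and collections enumerated by sequences -/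

theorem IsDisjointCollection.eq_of_mem {C : Set (Finset ℕ+)} (hC : IsDisjointCollection C)
    {d e : Finset ℕ+} (hd : d ∈ C) (he : e ∈ C) {y : ℕ+} (hyd : y ∈ d) (hye : y ∈ e) : d = e := by
  by_contra hne
  rcases hC.2 hd he hne with h | h
  · exact lt_irrefl _ (h y hyd y hye)
  · exact lt_irrefl _ (h y hye y hyd)

/-- A member not after `a` contains a point below or equal to some element of `a`. There are
finitely many such points, and each lies in at most one member. -/
theorem InfColl.finite_not_blockLT (D : InfColl) (a : Finset ℕ+) :
    {d ∈ D.carrier | ¬ BlockLT a d}.Finite := by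
  have hS : (⋃ x ∈ a, Set.Iic x).Finite := a.finite_toSet.biUnion fun x _ => Set.finite_Iic x
  refine (hS.biUnion (t := fun y => {d ∈ D.carrier | y ∈ d}) fun y _ => ?_).subset ?_
  · exact Set.Subsingleton.finite fun d hd e he =>
      D.isDisjointCollection.eq_of_mem hd.1 he.1 hd.2 he.2
  · rintro d ⟨hd, had⟩
    simp only [BlockLT, not_forall, not_lt] at had
    obtain ⟨x, hx, y, hy, hyx⟩ := had
    exact Set.mem_biUnion (Set.mem_biUnion hx hyx) ⟨hd, hy⟩

/-- The members of `D` that lie after `a`. -/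
def InfColl.tail (D : InfColl) (a : Finset ℕ+) : InfColl where
  carrier := {d ∈ D.carrier | BlockLT a d}
  infinite := by
    have h := D.infinite.sdiff (D.finite_not_blockLT a)
    refine h.mono fun d hd => ⟨hd.1, ?_⟩
    by_contra hn
    exact hd.2 ⟨hd.1, hn⟩
  isDisjointCollection :=
    ⟨fun d hd => D.isDisjointCollection.1 d hd.1,
      D.isDisjointCollection.2.mono fun _ hd => hd.1⟩

theorem InfColl.refines_tail (D : InfColl) (a : Finset ℕ+) : Refines (D.tail a) D :=
  fun _ hd => subset_FU _ hd.1

theorem injective_of_blockLT {d : ℕ → Finset ℕ+} (hlt : ∀ i j, i < j → BlockLT (d i) (d j))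
    (hne : ∀ n, (d n).Nonempty) : Function.Injective d := by
  intro i j hij
  by_contra hn
  obtain ⟨x, hx⟩ := hne i
  rcases lt_or_gt_of_ne hn with h | h
  · exact lt_irrefl _ (hlt i j h x hx x (hij ▸ hx))
  · exact lt_irrefl _ (hlt j i h x (hij ▸ hx) x hx)

/-- The infinite disjoint collection enumerated by a sequence of successive blocks. -/
def InfColl.ofSeq (d : ℕ → Finset ℕ+) (hne : ∀ n, (d n).Nonempty)
    (hlt : ∀ i j, i < j → BlockLT (d i) (d j)) : InfColl where
  carrier := Set.range d
  infinite := Set.infinite_range_of_injective (injective_of_blockLT hlt hne)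
  isDisjointCollection := by
    constructor
    · rintro _ ⟨n, rfl⟩
      exact hne n
    · rintro _ ⟨i, rfl⟩ _ ⟨j, rfl⟩ hij
      rcases lt_trichotomy i j with h | rfl | h
      · exact Or.inl (hlt _ _ h)
      · exact absurd rfl hij
      · exact Or.inr (hlt _ _ h)

/-- Diagonal sequences: if every `E` refining `D` has, after some member `d`, a refinement `E'`
with `Q d E'`, then these choices can be iterated. -/
theorem exists_diagonal_seq (Q : Finset ℕ+ → InfColl → Prop) (D : InfColl)
    (h : ∀ E, Refines E D → ∃ d ∈ E.carrier, ∃ E', Refines E' E ∧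
      (∀ e ∈ E'.carrier, BlockLT d e) ∧ Q d E') :
    ∃ (d : ℕ → Finset ℕ+) (E : ℕ → InfColl), Refines (E 0) D ∧ (∀ n, (d n).Nonempty) ∧
      (∀ i j, i < j → BlockLT (d i) (d j)) ∧ (∀ i j, i ≤ j → d j ∈ FU (E i).carrier) ∧
      ∀ n, Q (d n) (E (n + 1)) := by
  choose! d hd next hnext hlt hQ using h
  let E : ℕ → InfColl := fun n => next^[n] D
  have hsucc : ∀ n, E (n + 1) = next (E n) := fun n => Function.iterate_succ_apply' next n D
  have hED : ∀ n, Refines (E n) D := by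
    intro n
    induction n with
    | zero => exact Refines.refl D
    | succ n ih => rw [hsucc]; exact (hnext _ ih).trans ih
  have hanti : ∀ i j, i ≤ j → Refines (E j) (E i) := by
    intro i j hij
    induction j, hij using Nat.le_induction with
    | base => exact Refines.refl _
    | succ j _ ih => rw [hsucc]; exact (hnext _ (hED j)).trans ih
  have hmem : ∀ i j, i ≤ j → d (E j) ∈ FU (E i).carrier := fun i j hij =>
    hanti i j hij (hd _ (hED j))
  refine ⟨fun n => d (E n), E, hED 0, fun n => (E n).isDisjointCollection.1 _ (hd _ (hED n)), ?_,
    hmem, fun n => ?_⟩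
  · intro i j hij
    refine (Refines.refl (E (i + 1))).blockLT ?_ (hmem (i + 1) j hij)
    rw [hsucc]
    exact hlt _ (hED i)
  · rw [hsucc]
    exact hQ _ (hED n)

theorem InfColl.nonempty (D : InfColl) : D.carrier.Nonempty := D.infinite.nonempty

theorem Refines.ofSeq {D : InfColl} {d : ℕ → Finset ℕ+} {hne : ∀ n, (d n).Nonempty}
    {hlt : ∀ i j, i < j → BlockLT (d i) (d j)} (h : ∀ n, d n ∈ FU D.carrier) :
    Refines (InfColl.ofSeq d hne hlt) D := by
  rintro _ ⟨n, rfl⟩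
  exact h n

/-! ### The pigeonhole principle: Hindman's theorem for finite unions -/

open Classical in
/-- The union of two successive non-empty blocks, and `∅` for all other pairs. -/
noncomputable def blockMul (a b : Finset ℕ+) : Finset ℕ+ :=
  if a.Nonempty ∧ b.Nonempty ∧ BlockLT a b then a ∪ b else ∅

theorem blockMul_eq_union {a b : Finset ℕ+} (ha : a.Nonempty) (hb : b.Nonempty)
    (h : BlockLT a b) : blockMul a b = a ∪ b := if_pos ⟨ha, hb, h⟩

theorem nonempty_blockMul_iff {a b : Finset ℕ+} :
    (blockMul a b).Nonempty ↔ a.Nonempty ∧ b.Nonempty ∧ BlockLT a b := by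
  unfold blockMul
  split_ifs with h
  · simp [h, h.1.mono Finset.subset_union_left]
  · simpa using h

theorem blockMul_eq_empty {a b : Finset ℕ+} (h : ¬ (a.Nonempty ∧ b.Nonempty ∧ BlockLT a b)) :
    blockMul a b = ∅ := if_neg h

/-- `∅` is absorbing, so both sides are `a ∪ b ∪ c` when the three blocks are non-empty and
successive, and `∅` otherwise. A non-empty product thus certifies that its factors are successive.
-/
theorem blockMul_assoc (a b c : Finset ℕ+) :
    blockMul (blockMul a b) c = blockMul a (blockMul b c) := by
  by_cases hab : a.Nonempty ∧ b.Nonempty ∧ BlockLT a b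
  · by_cases hbc : b.Nonempty ∧ c.Nonempty ∧ BlockLT b c
    · obtain ⟨ha, hb, hab⟩ := hab
      obtain ⟨-, hc, hbc⟩ := hbc
      have hac := hab.trans hb hbc
      rw [blockMul_eq_union ha hb hab, blockMul_eq_union hb hc hbc,
        blockMul_eq_union (ha.mono Finset.subset_union_left) hc (hac.union_left hbc),
        blockMul_eq_union ha (hb.mono Finset.subset_union_left), Finset.union_assoc]
      intro x hx y hy
      rcases Finset.mem_union.1 hy with h | h
      · exact hab x hx y h
      · exact hac x hx y h
    · rw [blockMul_eq_empty hbc, blockMul_eq_empty, blockMul_eq_empty]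
      · simp
      · rw [blockMul_eq_union hab.1 hab.2.1 hab.2.2]
        exact fun h => hbc ⟨hab.2.1, h.2.1, h.2.2.mono Finset.subset_union_right subset_rfl⟩
  · rw [blockMul_eq_empty hab, blockMul_eq_empty, blockMul_eq_empty]
    · intro h
      obtain ⟨hb, hc, hbc⟩ := nonempty_blockMul_iff.1 h.2.1
      refine hab ⟨h.1, hb, h.2.2.mono subset_rfl ?_⟩
      rw [blockMul_eq_union hb hc hbc]
      exact Finset.subset_union_left
    · simp

/-- Finite sets of natural numbers as a semigroup under `blockMul`. -/
@[reducible] noncomputable def blockSemigroup : Semigroup (Finset ℕ+) where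
  mul := blockMul
  mul_assoc := blockMul_assoc

attribute [local instance] blockSemigroup

theorem mul_eq_blockMul (a b : Finset ℕ+) : a * b = blockMul a b := rfl

open Hindman in
-- `FP` multiplies terms in increasing order of index, so for successive blocks no product collapses
-- to `∅` and each is a genuine union.
theorem FP_subset_FU (a : Stream' (Finset ℕ+)) (hne : ∀ n, (a.get n).Nonempty)
    (hlt : ∀ i j, i < j → BlockLT (a.get i) (a.get j)) : FP a ⊆ FU (Set.range a.get) := by
  intro m hm
  induction hm with
  | head' a => exact subset_FU _ ⟨0, rfl⟩
  | tail' a m _ ih =>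
    refine FU_subset_FU ?_ (ih (fun n => hne (n + 1)) fun i j h => hlt _ _ (Nat.succ_lt_succ h))
    rintro _ ⟨n, rfl⟩
    exact subset_FU _ ⟨n + 1, rfl⟩
  | cons' a m _ ih =>
    have hm := ih (fun n => hne (n + 1)) fun i j h => hlt _ _ (Nat.succ_lt_succ h)
    have hm0 : m.Nonempty := by
      refine nonempty_of_mem_FU ?_ hm
      rintro _ ⟨n, rfl⟩
      exact hne (n + 1)
    have hlt' : BlockLT a.head m := by
      obtain ⟨f, -, hf, rfl⟩ := hm
      refine blockLT_biUnion_right.2 fun b hb => ?_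
      obtain ⟨n, rfl⟩ := hf hb
      exact hlt 0 (n + 1) n.succ_pos
    rw [mul_eq_blockMul, blockMul_eq_union (hne 0) hm0 hlt']
    refine union_mem_FU (subset_FU _ ⟨0, rfl⟩) (FU_subset_FU ?_ hm)
    rintro _ ⟨n, rfl⟩
    exact subset_FU _ ⟨n + 1, rfl⟩

open Hindman in
-- Peel off the least index of `g`: the product of its block with the rest is non-empty by `h0`,
-- hence equals the union. The offset `n` keeps the remaining indices in a later tail of the stream.
theorem biUnion_mem_FP (a : Stream' (Finset ℕ+)) (h0 : ∀ m ∈ FP a, m.Nonempty)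
    (g : Finset ℕ) (hg : g.Nonempty) (n : ℕ) (hn : ∀ i ∈ g, n ≤ i) :
    g.biUnion a.get ∈ FP (a.drop n) := by
  induction hc : g.card using Nat.strong_induction_on generalizing g n with
  | _ c ih =>
    set k := g.min' hg
    have hk : k ∈ g := g.min'_mem hg
    obtain ⟨l, hl⟩ := Nat.exists_eq_add_of_le (hn k hk)
    suffices h : g.biUnion a.get ∈ FP (a.drop k) by
      rw [hl, ← Stream'.drop_drop] at h
      exact FP_drop_subset_FP _ _ h
    have hhead : (a.drop k).head = a.get k := Stream'.head_drop ..
    rcases (g.erase k).eq_empty_or_nonempty with he | he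
    · have hgk : g = {k} := by
        rw [← Finset.insert_erase hk, he]
        rfl
      rw [hgk, Finset.singleton_biUnion, ← hhead]
      exact FP.head _
    · have hrest := ih _ (hc ▸ Finset.card_erase_lt_of_mem hk) (g.erase k) he (k + 1)
        (fun i hi => Nat.succ_le_of_lt (lt_of_le_of_ne (g.min'_le i (Finset.mem_of_mem_erase hi))
          (Finset.ne_of_mem_erase hi).symm)) rfl
      rw [← Stream'.drop_drop, ← Stream'.tail_eq_drop] at hrest
      have hcons := FP.cons _ _ hrest
      have hne := nonempty_blockMul_iff.1 (h0 _ (FP_drop_subset_FP _ _ hcons))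
      rw [mul_eq_blockMul, blockMul_eq_union hne.1 hne.2.1 hne.2.2, hhead] at hcons
      rwa [← Finset.insert_erase hk, Finset.biUnion_insert]

/-- Hindman's theorem for finite unions, relative to an infinite disjoint collection. -/
theorem exists_refines_FU_subset_or (D : InfColl) (A : Set (Finset ℕ+)) :
    ∃ D' : InfColl, Refines D' D ∧ (FU D'.carrier ⊆ A ∨ FU D'.carrier ⊆ Aᶜ) := by
  obtain ⟨d, E, hE, hne, hlt, hmem, -⟩ := exists_diagonal_seq (fun _ _ => True) D fun E _ => by
    obtain ⟨d, hd⟩ := E.nonempty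
    exact ⟨d, hd, E.tail d, E.refines_tail d, fun e he => he.2, trivial⟩
  let a : Stream' (Finset ℕ+) := d
  have hFP : Hindman.FP a ⊆ FU D.carrier := by
    refine (FP_subset_FU a hne hlt).trans (FU_subset_FU ?_)
    rintro _ ⟨n, rfl⟩
    exact hE.FU_subset (hmem 0 n n.zero_le)
  -- The colour classes are cut down to `FU D.carrier`, so all products from the homogeneous stream
  -- `b` are non-empty. This forces the blocks of `b` to be successive.
  obtain ⟨c, hc, b, hb⟩ := Hindman.FP_partition_regular a
    {FU D.carrier ∩ A, FU D.carrier ∩ Aᶜ} (Set.toFinite _) (by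
      intro m hm
      by_cases hmA : m ∈ A
      · exact ⟨_, Or.inl rfl, hFP hm, hmA⟩
      · exact ⟨_, Or.inr rfl, hFP hm, hmA⟩)
  have hbD : Hindman.FP b ⊆ FU D.carrier := by
    rcases hc with rfl | rfl <;> exact hb.trans Set.inter_subset_left
  have h0 : ∀ m ∈ Hindman.FP b, m.Nonempty := fun m hm => D.nonempty_of_mem_FU (hbD hm)
  have hsub : FU (Set.range b.get) ⊆ Hindman.FP b := by
    rintro _ ⟨f, hf, hfb, rfl⟩
    obtain ⟨g, rfl⟩ : ∃ g : Finset ℕ, g.image b.get = f := by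
      obtain ⟨g, -, hg⟩ := Finset.subset_set_image_iff.1 (hfb.trans Set.image_univ.symm.subset)
      exact ⟨g, hg⟩
    rw [Finset.image_biUnion]
    exact biUnion_mem_FP b h0 g (Finset.image_nonempty.1 hf) 0 fun i _ => i.zero_le
  refine ⟨InfColl.ofSeq b.get (fun n => h0 _ (Hindman.FP.singleton b n)) fun i j hij =>
    (nonempty_blockMul_iff.1 (h0 _ (Hindman.FP.mul_two b i j hij))).2.2,
    Refines.ofSeq fun n => hbD (Hindman.FP.singleton b n), ?_⟩
  rcases hc with rfl | rfl
  · exact Or.inl ((hsub.trans hb).trans Set.inter_subset_right)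
  · exact Or.inr ((hsub.trans hb).trans Set.inter_subset_right)

/-! ### Fusion -/

/-- A property of pairs `(t, E)` that depends only on the part of `FU(E)` after `t`, is inherited
by refinements, and can be achieved by refining, holds for all `t` of some fixed refinement. -/
theorem exists_fusion (P : Finset (Finset ℕ+) → InfColl → Prop) (D : InfColl)
    (hmono : ∀ t E E', {d ∈ E'.carrier | BlockLT (t.biUnion id) d} ⊆ FU E.carrier →
      P t E → P t E')
    (hex : ∀ t E, Refines E D → ∃ E', Refines E' E ∧ P t E') :
    ∃ E, Refines E D ∧ ∀ t ∈ finCollIn E, P t E := by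
  have hfin : ∀ (T : Finset (Finset (Finset ℕ+))) E, Refines E D →
      ∃ E', Refines E' E ∧ ∀ t ∈ T, P t E' := by
    intro T
    induction T using Finset.induction_on with
    | empty => exact fun E _ => ⟨E, Refines.refl E, by simp⟩
    | insert t T _ ih =>
      intro E hE
      obtain ⟨E₁, hE₁, h₁⟩ := ih E hE
      obtain ⟨E₂, hE₂, h₂⟩ := hex t E₁ (hE₁.trans hE)
      refine ⟨E₂, hE₂.trans hE₁, fun r hr => ?_⟩
      rcases Finset.mem_insert.1 hr with rfl | hr
      · exact h₂
      · exact hmono r E₁ E₂ (fun d hd => hE₂ hd.1) (h₁ r hr)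
  -- The empty collection has no last block, so the diagonal argument misses it; it is settled
  -- beforehand.
  obtain ⟨D₀, hD₀, h₀⟩ := hex ∅ D (Refines.refl D)
  -- After choosing `d`, settle every `t` bounded by `max d`. These form a finite set, so `hfin`
  -- applies.
  obtain ⟨d, E, hE, hne, hlt, hmem, hQ⟩ := exists_diagonal_seq
    (fun d E => ∀ t : Finset (Finset ℕ+), (∀ x ∈ t.biUnion id, ∃ y ∈ d, x ≤ y) → P t E) D₀ (by
      intro E hE
      obtain ⟨d, hd⟩ := E.nonempty
      obtain ⟨E', hE', h'⟩ := hfin (d.biUnion Finset.Iic).powerset.powerset (E.tail d)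
        (((E.refines_tail d).trans hE).trans hD₀)
      refine ⟨d, hd, E', hE'.trans (E.refines_tail d),
        fun e he => hE'.blockLT (fun _ h => h.2) (subset_FU _ he), fun t ht => h' t ?_⟩
      refine Finset.mem_powerset.2 fun u hu => Finset.mem_powerset.2 fun x hx => ?_
      obtain ⟨y, hy, hxy⟩ := ht x (Finset.mem_biUnion.2 ⟨u, hu, hx⟩)
      exact Finset.mem_biUnion.2 ⟨y, hy, Finset.mem_Iic.2 hxy⟩)
  have href : Refines (InfColl.ofSeq d hne hlt) D₀ :=
    Refines.ofSeq fun n => hE.FU_subset (hmem 0 n n.zero_le)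
  refine ⟨InfColl.ofSeq d hne hlt, href.trans hD₀, fun t ht => ?_⟩
  rcases t.eq_empty_or_nonempty with rfl | htne
  · exact hmono _ _ _ (fun e he => href he.1) h₀
  obtain ⟨f, hf, hfd, hft⟩ := biUnion_mem_FU htne fun a ha => ht.2 ha
  obtain ⟨g, rfl⟩ : ∃ g : Finset ℕ, g.image d = f := by
    obtain ⟨g, -, hg⟩ := Finset.subset_set_image_iff.1 (hfd.trans Set.image_univ.symm.subset)
    exact ⟨g, hg⟩
  have hg : g.Nonempty := Finset.image_nonempty.1 hf
  set n := g.max' hg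
  have hn : d n ⊆ t.biUnion id := by
    rw [hft]
    exact Finset.subset_biUnion_of_mem id (Finset.mem_image_of_mem d (g.max'_mem hg))
  -- `d n` is the last block used in `⋃ t`, so `t` was settled by `E (n + 1)`, and every `d m` after
  -- `t` has `m > n`, hence lies in `FU (E (n + 1))`.
  refine hmono t (E (n + 1)) _ ?_ (hQ n t fun x hx => ?_)
  · rintro _ ⟨⟨m, rfl⟩, hm⟩
    refine hmem _ _ (Nat.succ_le_of_lt ?_)
    by_contra hmn
    obtain ⟨x, hx⟩ := hne m
    obtain ⟨y, hy⟩ := hne n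
    have hyx := hm y (hn hy) x hx
    rcases (not_lt.1 hmn).eq_or_lt with h | h
    · exact lt_irrefl _ (hm x (hn (h ▸ hx)) x hx)
    · exact lt_asymm hyx (hlt m n h x hx y hy)
  · rw [hft] at hx
    obtain ⟨_, he, hxe⟩ := Finset.mem_biUnion.1 hx
    obtain ⟨i, hi, rfl⟩ := Finset.mem_image.1 he
    rcases (g.le_max' i hi).eq_or_lt with h | h
    · exact ⟨x, h.subst (motive := fun k => x ∈ d k) hxe, le_rfl⟩
    · obtain ⟨y, hy⟩ := hne n
      exact ⟨y, hy, (hlt i n h x hxe y hy).le⟩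

/-! ### Basic sets and the topology -/

theorem basicSet_subset_of_tail {s : Finset (Finset ℕ+)} {E E' : InfColl}
    (h : {d ∈ E'.carrier | BlockLT (s.biUnion id) d} ⊆ FU E.carrier) :
    basicSet s E' ⊆ basicSet s E := fun _ hG =>
  ⟨hG.1, fun _ hd => mem_FU_of_blockLT h (hG.2 hd) hd.2⟩

theorem IsInitialSegment.blockLT_biUnion {t : Finset (Finset ℕ+)} {G : InfColl}
    (h : IsInitialSegment t G) {b : Finset ℕ+} (hb : b ∈ G.carrier) (hbt : b ∉ t) :
    BlockLT (t.biUnion id) b := blockLT_biUnion_left.2 fun a ha => h.2 a ha b hb hbt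

theorem IsInitialSegment.union {t t' : Finset (Finset ℕ+)} {G : InfColl}
    (h : IsInitialSegment t G) (h' : IsInitialSegment t' G) : IsInitialSegment (t ∪ t') G := by
  refine ⟨by rw [Finset.coe_union]; exact Set.union_subset h.1 h'.1, fun a ha b hb hbn => ?_⟩
  rw [Finset.mem_union, not_or] at hbn
  rcases Finset.mem_union.1 ha with ha | ha
  · exact h.2 a ha b hb hbn.1
  · exact h'.2 a ha b hb hbn.2

/-- Every open set containing `G` contains the basic set `[t, G]` for all large initial segments
`t` of `G`. -/
theorem exists_basicSet_subset_of_isOpen {O : Set InfColl}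
    (hO : @IsOpen InfColl ellentuckTopology O)
    {G : InfColl} (hG : G ∈ O) : ∃ t₀, IsInitialSegment t₀ G ∧
      ∀ t, t₀ ⊆ t → IsInitialSegment t G → basicSet t G ⊆ O := by
  have hO' : TopologicalSpace.GenerateOpen
      {V | ∃ s ∈ FinColl, ∃ D : InfColl, V = basicSet s D} O := hO
  clear hO
  induction hO' with
  | basic V hV =>
    obtain ⟨s, -, D, rfl⟩ := hV
    refine ⟨s, hG.1, fun t hst ht H hH => ⟨⟨fun a ha => hH.1.1 (hst ha), ?_⟩, ?_⟩⟩
    · intro a ha b hb hbs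
      by_cases hbt : b ∈ t
      · exact hG.1.2 a ha b (ht.1 hbt) hbs
      · exact hH.1.2 a (hst ha) b hb hbt
    · rintro b ⟨hb, hsb⟩
      by_cases hbt : b ∈ t
      · exact hG.2 ⟨ht.1 hbt, hsb⟩
      · exact mem_FU_of_blockLT hG.2 (hH.2 ⟨hb, hH.1.blockLT_biUnion hb hbt⟩) hsb
  | univ => exact ⟨∅, ⟨by simp, by simp⟩, fun _ _ _ => Set.subset_univ _⟩
  | inter V W _ _ ihV ihW =>
    obtain ⟨t₁, h₁, h₁'⟩ := ihV hG.1
    obtain ⟨t₂, h₂, h₂'⟩ := ihW hG.2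
    exact ⟨t₁ ∪ t₂, h₁.union h₂, fun t ht hti => Set.subset_inter
      (h₁' t (Finset.union_subset_left ht) hti) (h₂' t (Finset.union_subset_right ht) hti)⟩
  | sUnion S _ ih =>
    obtain ⟨V, hV, hGV⟩ := hG
    obtain ⟨t₀, h, h'⟩ := ih V hV hGV
    exact ⟨t₀, h, fun t ht hti => (h' t ht hti).trans (Set.subset_sUnion_of_mem hV)⟩

/-- `G` has a first member after each of its initial segments. -/
theorem IsInitialSegment.exists_insert {t : Finset (Finset ℕ+)} {G : InfColl}
    (h : IsInitialSegment t G) :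
    ∃ x ∈ G.carrier, x ∉ t ∧ IsInitialSegment (insert x t) G := by
  have hne : (G.carrier \ t).Nonempty := (G.infinite.sdiff t.finite_toSet).nonempty
  -- Among successive blocks, the first is the one with least minimum.
  obtain ⟨x, ⟨hx, hxt⟩, hmin⟩ :=
    WellFounded.has_min (InvImage.wf blockMin wellFounded_lt) _ hne
  refine ⟨x, hx, hxt, fun a ha => ?_, fun a ha b hb hbn => ?_⟩
  · rcases Finset.mem_insert.1 ha with rfl | ha
    · exact hx
    · exact h.1 ha
  · rw [Finset.mem_insert, not_or] at hbn
    rcases Finset.mem_insert.1 ha with rfl | ha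
    · refine (G.isDisjointCollection.2 hx hb (Ne.symm hbn.1)).resolve_right fun hlt => ?_
      refine hmin b ⟨hb, hbn.2⟩ ?_
      have hb0 := G.isDisjointCollection.1 b hb
      have ha0 := G.isDisjointCollection.1 a hx
      simp only [InvImage, blockMin, dif_pos hb0, dif_pos ha0]
      exact hlt _ (b.min'_mem hb0) _ (a.min'_mem ha0)
    · exact h.2 a ha b hb hbn.2

/-! ### Accepting and rejecting -/

/-- `E` rejects `s`: no refinement `E'` of `E` has `[s, E'] ⊆ O`. -/
def Rejects (O : Set InfColl) (s : Finset (Finset ℕ+)) (E : InfColl) : Prop :=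
  ∀ E', Refines E' E → ¬ basicSet s E' ⊆ O

/-- An accepting refinement of `E'`, cut to its tail past `⋃ s`, refines `E` and still accepts,
since its basic set only shrinks. -/
theorem Rejects.of_tail {O : Set InfColl} {s : Finset (Finset ℕ+)} {E E' : InfColl}
    (h : {d ∈ E'.carrier | BlockLT (s.biUnion id) d} ⊆ FU E.carrier) (hE : Rejects O s E) :
    Rejects O s E' := fun E'' hE'' hacc =>
  hE (E''.tail (s.biUnion id)) (fun _ hd => mem_FU_of_blockLT h (hE'' hd.1) hd.2)
    ((basicSet_subset_of_tail fun _ hd => E''.refines_tail _ hd.1).trans hacc)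

theorem finCollIn_insert {D : InfColl} {t : Finset (Finset ℕ+)} {x : Finset ℕ+}
    (ht : t ∈ finCollIn D) (hx : x ∈ FU D.carrier) (htx : BlockLT (t.biUnion id) x) :
    insert x t ∈ finCollIn D := by
  refine ⟨⟨fun a ha => ?_, ?_⟩, ?_⟩
  · rcases Finset.mem_insert.1 ha with rfl | ha
    · exact D.nonempty_of_mem_FU hx
    · exact ht.1.1 a ha
  · rw [Finset.coe_insert]
    exact ht.1.2.insert fun b hb _ => ⟨Or.inr (blockLT_biUnion_left.1 htx b hb),
      Or.inl (blockLT_biUnion_left.1 htx b hb)⟩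
  · rw [Finset.coe_insert]
    exact Set.insert_subset hx ht.2

/-- A finite collection is built by appending blocks on the right; the last block is the one with
largest minimum. -/
theorem finCollIn_induction {D : InfColl} {p : Finset (Finset ℕ+) → Prop} (h0 : p ∅)
    (hstep : ∀ t ∈ finCollIn D, ∀ x ∈ FU D.carrier, BlockLT (t.biUnion id) x → p t →
      p (insert x t)) : ∀ t ∈ finCollIn D, p t := by
  intro t ht
  induction hc : t.card generalizing t with
  | zero => rwa [Finset.card_eq_zero.1 hc]
  | succ n ih =>
    have hne : t.Nonempty := Finset.card_pos.1 (hc ▸ n.succ_pos)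
    obtain ⟨x, hx, hmax⟩ := t.exists_max_image blockMin hne
    have hsub : t.erase x ∈ finCollIn D :=
      ⟨⟨fun a ha => ht.1.1 a (Finset.mem_of_mem_erase ha),
        ht.1.2.mono fun a ha => Finset.mem_of_mem_erase ha⟩,
        fun a ha => ht.2 (Finset.mem_of_mem_erase ha)⟩
    rw [← Finset.insert_erase hx]
    refine hstep _ hsub x (ht.2 hx) (blockLT_biUnion_left.2 fun a ha => ?_)
      (ih _ hsub (by rw [Finset.card_erase_of_mem hx, hc]; rfl))
    have hat := Finset.mem_of_mem_erase ha
    refine (ht.1.2 hat hx (Finset.ne_of_mem_erase ha)).resolve_right fun hlt => ?_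
    have ha0 := ht.1.1 a hat
    have hx0 := ht.1.1 x hx
    refine (hmax a hat).not_gt ?_
    simp only [blockMin, dif_pos ha0, dif_pos hx0]
    exact hlt _ (x.min'_mem hx0) _ (a.min'_mem ha0)

theorem blockLT_of_blockLT_union {s t : Finset (Finset ℕ+)} {d : Finset ℕ+}
    (h : BlockLT ((s ∪ t).biUnion id) d) : BlockLT (t.biUnion id) d :=
  h.mono (Finset.biUnion_subset_biUnion_of_subset_left id Finset.subset_union_right) subset_rfl

/-- Open families are Ramsey: the topological form of Milliken's theorem. -/
theorem exists_refines_basicSet_subset_or (O : Set InfColl)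
    (hO : @IsOpen InfColl ellentuckTopology O)
    (s : Finset (Finset ℕ+)) (D : InfColl) :
    ∃ D₁, Refines D₁ D ∧ (basicSet s D₁ ⊆ O ∨ basicSet s D₁ ⊆ Oᶜ) := by
  -- `D₁` decides `s ∪ t`, by accepting or rejecting, for each `t` it generates.
  obtain ⟨D₁, hD₁, hdec⟩ := exists_fusion
    (fun t E => basicSet (s ∪ t) E ⊆ O ∨ Rejects O (s ∪ t) E) D
    (by
      intro t E E' h hP
      have h' : {d ∈ E'.carrier | BlockLT ((s ∪ t).biUnion id) d} ⊆ FU E.carrier :=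
        fun d hd => h ⟨hd.1, blockLT_of_blockLT_union hd.2⟩
      exact hP.imp (basicSet_subset_of_tail h').trans (Rejects.of_tail h'))
    (by
      intro t E _
      by_cases h : Rejects O (s ∪ t) E
      · exact ⟨E, Refines.refl E, Or.inr h⟩
      · simp only [Rejects, not_forall, not_not] at h
        obtain ⟨E', hE', h⟩ := h
        exact ⟨E', hE', Or.inl h⟩)
  -- On `D₂`, rejection by `D₁` passes from `s ∪ t` to every one-block extension.
  obtain ⟨D₂, hD₂, hrej⟩ := exists_fusion
    (fun t E => t ∈ finCollIn D₁ → Rejects O (s ∪ t) D₁ → ∀ x ∈ FU E.carrier,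
      BlockLT (t.biUnion id) x → Rejects O (s ∪ insert x t) D₁) D₁
    (fun t E E' h hP ht hr x hx htx => hP ht hr x (mem_FU_of_blockLT h hx htx) htx)
    (by
      intro t E hE
      obtain ⟨E', hE', h⟩ :=
        exists_refines_FU_subset_or E {x | Rejects O (s ∪ insert x t) D₁}
      refine ⟨E', hE', fun ht hr x hx _ => ?_⟩
      rcases h with h | h
      · exact h hx
      -- If no later block `x` of `FU(E')` gives a rejected extension, `D₁` accepts them all. Any
      -- `G` in `[s ∪ t, E']` has a next block `y`, so it lies in an accepted basic set; then `E'`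
      -- accepts `s ∪ t`, a contradiction.
      · refine absurd (fun G hG => ?_) (hr E' (hE'.trans hE))
        obtain ⟨y, hyG, hyt, hy⟩ := hG.1.exists_insert
        have hty := hG.1.blockLT_biUnion hyG hyt
        have hyE := hG.2 ⟨hyG, hty⟩
        have hyD : y ∈ FU D₁.carrier := (hE'.trans hE).FU_subset hyE
        have hacc := (hdec _ (finCollIn_insert ht hyD (blockLT_of_blockLT_union hty))).resolve_right
          (h hyE)
        refine hacc ⟨by rwa [Finset.union_insert], fun d hd => ?_⟩
        refine (hE'.trans hE).FU_subset (hG.2 ⟨hd.1, hd.2.mono ?_ subset_rfl⟩)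
        rw [Finset.union_insert]
        exact Finset.biUnion_subset_biUnion_of_subset_left id (Finset.subset_insert _ _))
  have hmem : ∀ t ∈ finCollIn D₂, t ∈ finCollIn D₁ := fun t ht =>
    ⟨ht.1, fun a ha => hD₂.FU_subset (ht.2 ha)⟩
  rcases hdec ∅ ⟨⟨by simp, by simp⟩, by simp⟩ with hacc | hr
  · exact ⟨D₁, hD₁, Or.inl (by simpa using hacc)⟩
  refine ⟨D₂, hD₂.trans hD₁, Or.inr fun G hG hGO => ?_⟩
  have hall : ∀ t ∈ finCollIn D₂, Rejects O (s ∪ t) D₁ :=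
    finCollIn_induction hr fun t ht x hx htx ih => hrej t ht (hmem t ht) ih x hx htx
  -- Openness gives an initial segment `s ∪ t₀` of `G` with `[s ∪ t₀, G] ⊆ O`. A tail of `G` refines
  -- `D₁`, contradicting the rejection of `s ∪ (t₀ \ s)`.
  obtain ⟨t₀, ht₀, hsub⟩ := exists_basicSet_subset_of_isOpen hO hGO
  have hst : s ∪ t₀ \ s = s ∪ t₀ := Finset.union_sdiff_self_eq_union
  have hinit := hG.1.union ht₀
  have ht : t₀ \ s ∈ finCollIn D₂ := by
    refine ⟨⟨fun a ha => ?_, ?_⟩, fun a ha => ?_⟩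
    · exact G.isDisjointCollection.1 a (ht₀.1 (Finset.mem_sdiff.1 ha).1)
    · exact G.isDisjointCollection.2.mono fun a ha => ht₀.1 (Finset.mem_sdiff.1 ha).1
    · obtain ⟨hat, has⟩ := Finset.mem_sdiff.1 ha
      exact hG.2 ⟨ht₀.1 hat, hG.1.blockLT_biUnion (ht₀.1 hat) has⟩
  refine hall _ ht (G.tail ((s ∪ t₀).biUnion id)) ?_ ?_
  · rintro d ⟨hd, hlt⟩
    refine hD₂.FU_subset (hG.2 ⟨hd, hlt.mono ?_ subset_rfl⟩)
    exact Finset.biUnion_subset_biUnion_of_subset_left id Finset.subset_union_left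
  · rw [hst]
    exact (basicSet_subset_of_tail fun _ hd => G.refines_tail _ hd.1).trans
      (hsub _ Finset.subset_union_right hinit)

/-- If `t` lies after `s` and has its members in `FU(D)`, then `[s ∪ t, D] ⊆ [s, D]`. -/
theorem basicSet_union_subset {s t : Finset (Finset ℕ+)} {D : InfColl}
    (ht : (t : Set (Finset ℕ+)) ⊆ FU D.carrier) (hst : ∀ a ∈ s, ∀ b ∈ t, BlockLT a b) :
    basicSet (s ∪ t) D ⊆ basicSet s D := by
  rintro G ⟨hG, hGD⟩
  refine ⟨⟨fun a ha => hG.1 (Finset.mem_union_left t ha), fun a ha b hb hbs => ?_⟩, ?_⟩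
  · by_cases hbt : b ∈ t
    · exact hst a ha b hbt
    · exact hG.2 a (Finset.mem_union_left t ha) b hb (by simp [hbs, hbt])
  · rintro d ⟨hd, hsd⟩
    by_cases hdt : d ∈ t
    · exact ht hdt
    · refine hGD ⟨hd, hG.blockLT_biUnion hd ?_⟩
      rw [Finset.mem_union, not_or]
      refine ⟨fun hds => ?_, hdt⟩
      obtain ⟨x, hx⟩ := G.isDisjointCollection.1 d hd
      exact lt_irrefl _ (blockLT_biUnion_left.1 hsd d hds x hx x hx)

end BlockSchreier

theorem theorem4p2
    (lam : Ordinal.{0} → ℕ+ → Ordinal.{0}) (hlam : BlockSchreier.IsFundamentalChoice lam)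
    (U : Set BlockSchreier.InfColl)
    (s : Finset (Finset ℕ+)) (hs : s ∈ BlockSchreier.FinColl)
    (D : BlockSchreier.InfColl) :
    (∃ D₁ : BlockSchreier.InfColl, BlockSchreier.Refines D₁ D ∧
      BlockSchreier.basicSet s D₁ ⊆ BlockSchreier.ellentuckClosure U) ∨
    (∃ ξ₀ : Ordinal.{0}, ξ₀ < ω₁ ∧
      ∀ ξ : Ordinal.{0}, ξ₀ < ξ → ξ < ω₁ →
        ∃ D₁ : BlockSchreier.InfColl, BlockSchreier.Refines D₁ D ∧
          ∀ t ∈ BlockSchreier.blockFamily lam ξ ∩ BlockSchreier.finCollIn D₁,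
            BlockSchreier.basicSet (s ∪ t) D₁ ⊆ Uᶜ) := by
  open BlockSchreier in
  -- Working below the tail past `⋃ s` puts every block generated by `D₁` after `s`.
  obtain ⟨D₁, hD₁, h⟩ := exists_refines_basicSet_subset_or (ellentuckClosure U)ᶜ
    (@isClosed_closure InfColl ellentuckTopology U).isOpen_compl s (D.tail (s.biUnion id))
  rcases h with h | h
  · refine Or.inr ⟨0, Ordinal.omega_pos 1, fun ξ _ _ =>
      ⟨D₁, hD₁.trans (D.refines_tail _), fun t ht => ?_⟩⟩
    have hst : ∀ a ∈ s, ∀ b ∈ t, BlockLT a b := fun a ha b hb =>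
      blockLT_biUnion_left.1 (hD₁.blockLT (fun _ hd => hd.2) (ht.2.2 hb)) a ha
    exact ((basicSet_union_subset ht.2.2 hst).trans h).trans
      (Set.compl_subset_compl.2 (@subset_closure InfColl ellentuckTopology U))
  · exact Or.inl ⟨D₁, hD₁.trans (D.refines_tail _), by rwa [compl_compl] at h⟩
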